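/- Let $\mathbb K$ be $\mathbb R$ or $\mathbb C$. A topological vector space over $\mathbb K$ is weakly complete if it is isomorphic to a power $\mathbb K^J$. Let $\mathcal{WA}$ be the category of weakly complete associative unital $\mathbb K$-algebras (with jointly continuous multiplication) and continuous unital algebra morphisms. Let $\mathcal{WL}$ be the category of profinite-dimensional Lie algebras, that is, topological $\mathbb K$-Lie algebras $\mathfrak g$ for which the canonical map $\mathfrak g\to\lim_I \mathfrak g/I$ is an isomorphism of topological Lie algebras, where $I$ ranges over the closed ideals with $\dim\mathfrak g/I<\infty$; its morphisms are the continuous Lie algebra morphisms. For $A$ in $\mathcal{WA}$ let $A_{\rm Lie}$ in $\mathcal{WL}$ be $A$ with the bracket $[x,y]=xy-yx$. Let $\mathbf U\colon\mathcal{WL}\to\mathcal{WA}$ be the left adjoint of $A\mapsto A_{\rm Lie}$ (the weakly complete enveloping algebra functor), with unit $\lambda_{\mathfrak g}\colon\mathfrak g\to\mathbf U(\mathfrak g)_{\rm Lie}$. (i) Let $\mathfrak g$ be in $\mathcal{WL}$, let $W$ be in $\mathcal{WA}$ and let $j\colon\mathfrak g\to W_{\rm Lie}$ be a morphism in $\mathcal{WL}$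 (for instance an inclusion) such that for each finite-dimensional $A$ in $\mathcal{WA}$ and each morphism $f\colon\mathfrak g\to A_{\rm Lie}$ in $\mathcal{WL}$ there is a unique morphism $f'\colon W\to A$ in $\mathcal{WA}$ with $f'_{\rm Lie}\circ j=f$. Then the same holds for every $A$ in $\mathcal{WA}$, and there is a unique isomorphism $e\colon W\to\mathbf U(\mathfrak g)$ in $\mathcal{WA}$ with $e_{\rm Lie}\circ j=\lambda_{\mathfrak g}$. (ii) Let $\mathbf V\colon\mathcal{WL}\to\mathcal{WA}$ be a functor with a natural morphism $\nu_{\mathfrak g}\colon\mathfrak g\to\mathbf V(\mathfrak g)_{\rm Lie}$ such that, for every $\mathfrak g$ in $\mathcal{WL}$, each finite-dimensional $A$ in $\mathcal{WA}$ and each morphism $f\colon\mathfrak g\to A_{\rm Lie}$ in $\mathcal{WL}$, there is a unique morphism $f'\colon\mathbf V(\mathfrak g)\to A$ in $\mathcal{WA}$ with $f'_{\rm Lie}\circ\nu_{\mathfrak g}=f$. Then there is a unique natural isomorphism $e\colon\mathbf V\to\mathbf U$ with $(e_{\mathfrak g})_{\rm Lie}\circ\nu_{\mathfrak g}=\lambda_{\mathfrak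 g}$ for all $\mathfrak g$. -/

import Mathlib

open CategoryTheory Topology

attribute [local instance] LieRing.ofAssociativeRing

universe u

/-- A topological vector space over `K` is weakly complete if it is isomorphic, as a topological
vector space, to a power `K ^ J` with the product topology. -/
def IsWeaklyComplete (K : Type) [RCLike K] (E : Type u) [AddCommGroup E] [Module K E]
    [TopologicalSpace E] : Prop :=
  ∃ J : Type u, Nonempty (E ≃L[K] (J → K))

namespace WeaklyCompleteAux

theorem isClosed_range {E G : Type*} [AddCommGroup E] [UniformSpace E] [IsUniformAddGroup E]
    [CompleteSpace E] [AddCommGroup G] [TopologicalSpace G] [IsTopologicalAddGroup G] [T2Space G]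
    (f : E →+ G) (hf : IsInducing f) : IsClosed (Set.range f) := by
  let _ : UniformSpace G := IsTopologicalAddGroup.rightUniformSpace G
  have : IsUniformAddGroup G := isUniformAddGroup_of_addCommGroup
  have h := AddMonoidHom.isUniformInducing_of_isInducing (f := f) hf
  exact ((completeSpace_iff_isComplete_range h).1 inferInstance).isClosed

theorem mem_range_of_finset {E ι : Type*} {G : ι → Type*} [AddCommGroup E] [UniformSpace E]
    [IsUniformAddGroup E] [CompleteSpace E] [∀ i, AddCommGroup (G i)] [∀ i, TopologicalSpace (G i)]
    [∀ i, IsTopologicalAddGroup (G i)] [∀ i, T2Space (G i)] (f : E →+ ∀ i, G i)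
    (hf : IsInducing f) (y : ∀ i, G i) (hy : ∀ s : Finset ι, ∃ e, ∀ i ∈ s, f e i = y i) :
    ∃ e, f e = y := by
  have h := isClosed_range f hf
  have : y ∈ closure (Set.range f) := by
    rw [mem_closure_iff_nhds]
    intro t ht
    rw [nhds_pi, Filter.mem_pi'] at ht
    obtain ⟨s, u, hu, hs⟩ := ht
    obtain ⟨e, he⟩ := hy s
    exact ⟨f e, hs fun i hi => by rw [he i hi]; exact mem_of_mem_nhds (hu i), e, rfl⟩
  rw [h.closure_eq] at this
  exact this

theorem exists_finset_of_nhds {K J : Type*} [RCLike K] {U : Set (J → K)} (hU : U ∈ 𝓝 (0 : J → K)) :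
    ∃ F : Finset J, ∀ x : J → K, (∀ i ∈ F, x i = 0) → x ∈ U := by
  rw [nhds_pi, Filter.mem_pi'] at hU
  obtain ⟨s, u, hu, hs⟩ := hU
  exact ⟨s, fun x hx => hs fun i hi => by rw [hx i hi]; exact mem_of_mem_nhds (hu i)⟩

theorem exists_finset_of_continuous {K J : Type*} [RCLike K] (l : (J → K) →ₗ[K] K)
    (hl : Continuous l) : ∃ F : Finset J, ∀ x : J → K, (∀ i ∈ F, x i = 0) → l x = 0 := by
  have hU : l ⁻¹' (Metric.ball 0 1) ∈ 𝓝 (0 : J → K) :=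
    hl.continuousAt.preimage_mem_nhds (by rw [map_zero]; exact Metric.ball_mem_nhds _ one_pos)
  obtain ⟨F, hF⟩ := exists_finset_of_nhds hU
  refine ⟨F, fun x hx => ?_⟩
  by_contra h
  have := hF ((l x)⁻¹ • x) (fun i hi => by simp [hx i hi])
  simp [h] at this

theorem continuous_of_finset {K J : Type*} [RCLike K] (l : (J → K) →ₗ[K] K) (F : Finset J)
    (hF : ∀ x : J → K, (∀ i ∈ F, x i = 0) → l x = 0) : Continuous l := by
  classical
  have : ∀ x, l x = ∑ i ∈ F, x i * l (Pi.single i 1) := by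
    intro x
    have h := hF (x - ∑ i ∈ F, x i • Pi.single i 1) (fun j hj => by
      simp [Finset.sum_apply, Pi.single_apply, hj])
    rw [map_sub, sub_eq_zero, map_sum] at h
    rw [h]
    simp
  rw [show (l : (J → K) → K) = fun x => ∑ i ∈ F, x i * l (Pi.single i 1) from funext this]
  fun_prop

/-- Closed subspaces of powers of `K` are weakly complete. -/
theorem isWeaklyComplete_of_isClosed {K : Type} [RCLike K] {ι : Type u} (S : Submodule K (ι → K))
    (hS : IsClosed (S : Set (ι → K))) : IsWeaklyComplete K S := by
  classical
  obtain ⟨κ, a, -, hspan, hli⟩ := exists_linearIndependent' K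
    (fun i : ι => (LinearMap.proj i : (ι → K) →ₗ[K] K).comp S.subtype)
  have : CompleteSpace S := hS.completeSpace_coe
  have : IsUniformAddGroup S := S.toAddSubgroup.isUniformAddGroup
  let f : S →L[K] (κ → K) :=
    ContinuousLinearMap.pi fun k => (ContinuousLinearMap.proj (a k)).comp S.subtypeL
  have hind : IsInducing f := by
    choose c hc using fun i : ι => (Finsupp.mem_span_range_iff_exists_finsupp (R := K)).1
      (hspan.ge (Submodule.subset_span ⟨i, rfl⟩))
    have hg : Continuous fun (y : κ → K) (i : ι) => (c i).sum fun k t => t * y k := by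
      refine continuous_pi fun i => ?_
      simp only [Finsupp.sum]
      fun_prop
    refine IsInducing.of_comp f.continuous hg ?_
    have : ((fun (y : κ → K) (i : ι) => (c i).sum fun k t => t * y k) ∘ f) = Subtype.val := by
      funext x i
      have := congrArg (fun l => l x) (hc i)
      simp only [Finsupp.sum, LinearMap.sum_apply] at this
      simpa [f, Finsupp.sum] using this
    rw [this]
    exact IsInducing.subtypeVal
  have hsurj : Function.Surjective f := by
    intro y
    refine mem_range_of_finset (f : S →+ (κ → K)) hind y fun s => ?_
    let L : S →ₗ[K] (s → K) := LinearMap.pi fun k =>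
      (LinearMap.proj (a k) : (ι → K) →ₗ[K] K).comp S.subtype
    have hL : LinearMap.range L = ⊤ := by
      by_contra hne
      obtain ⟨φ, hφ, hle⟩ := Submodule.exists_le_ker_of_lt_top _ (lt_top_iff_ne_top.2 hne)
      apply hφ
      have h2 := Fintype.linearIndependent_iff.1 (hli.comp (Subtype.val : s → κ)
        Subtype.val_injective) (fun k => φ (Pi.single k 1)) (by
          ext x
          have h3 : φ (L x) = 0 := hle ⟨x, rfl⟩
          rw [← Finset.univ_sum_single (L x), map_sum] at h3
          simp only [LinearMap.sum_apply]
          rw [LinearMap.zero_apply, ← h3]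
          refine Finset.sum_congr rfl fun k _ => ?_
          have : (Pi.single k (L x k) : s → K) = L x k • Pi.single k 1 := by
            ext j; simp [Pi.single_apply]
          rw [this, map_smul]
          simp [L, mul_comm])
      ext k
      simpa using h2 k
    obtain ⟨x, hx⟩ := LinearMap.range_eq_top.1 hL (fun k => y k)
    exact ⟨x, fun k hk => congrFun hx ⟨k, hk⟩⟩
  have hinj : Function.Injective f := hind.injective
  exact ⟨κ, ⟨{ LinearEquiv.ofBijective (f : S →ₗ[K] (κ → K)) ⟨hinj, hsurj⟩ with
    continuous_toFun := f.continuous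
    continuous_invFun := by
      rw [hind.continuous_iff]
      convert! continuous_id using 1
      funext y
      exact (LinearEquiv.ofBijective (f : S →ₗ[K] (κ → K)) ⟨hinj, hsurj⟩).apply_symm_apply y }⟩⟩

theorem _root_.IsWeaklyComplete.of_equiv {K : Type} [RCLike K] {E F : Type u} [AddCommGroup E] [Module K E]
    [TopologicalSpace E] [AddCommGroup F] [Module K F] [TopologicalSpace F]
    (hF : IsWeaklyComplete K F) (e : E ≃L[K] F) : IsWeaklyComplete K E := by
  obtain ⟨J, ⟨e'⟩⟩ := hF
  exact ⟨J, ⟨e.trans e'⟩⟩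

theorem _root_.IsWeaklyComplete.isClosed_range {K : Type} [RCLike K] {E : Type u} {G : Type*}
    [AddCommGroup E] [Module K E] [TopologicalSpace E] [AddCommGroup G] [TopologicalSpace G]
    [IsTopologicalAddGroup G] [T2Space G] (hE : IsWeaklyComplete K E)
    (f : E →+ G) (hf : IsInducing f) : IsClosed (Set.range f) := by
  obtain ⟨J, ⟨e⟩⟩ := hE
  have := WeaklyCompleteAux.isClosed_range (f.comp (e.symm : (J → K) →+ E))
    (hf.comp e.symm.toHomeomorph.isInducing)
  rwa [AddMonoidHom.coe_comp, Set.range_comp, show Set.range (e.symm : (J → K) →+ E) = Set.univ from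
    e.symm.surjective.range_eq, Set.image_univ] at this

theorem _root_.IsWeaklyComplete.mem_range_of_finset {K : Type} [RCLike K] {E : Type u} {ι : Type*}
    {G : ι → Type*} [AddCommGroup E] [Module K E] [TopologicalSpace E] [∀ i, AddCommGroup (G i)]
    [∀ i, TopologicalSpace (G i)] [∀ i, IsTopologicalAddGroup (G i)] [∀ i, T2Space (G i)]
    (hE : IsWeaklyComplete K E) (f : E →+ ∀ i, G i) (hf : IsInducing f)
    (y : ∀ i, G i) (hy : ∀ s : Finset ι, ∃ e, ∀ i ∈ s, f e i = y i) :
    ∃ e, f e = y := by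
  obtain ⟨J, ⟨e⟩⟩ := hE
  obtain ⟨x, hx⟩ := WeaklyCompleteAux.mem_range_of_finset (f.comp (e.symm : (J → K) →+ E))
    (hf.comp e.symm.toHomeomorph.isInducing) y (fun s => by
      obtain ⟨z, hz⟩ := hy s
      exact ⟨e z, by simpa using hz⟩)
  exact ⟨e.symm x, hx⟩

theorem _root_.IsWeaklyComplete.t2Space {K : Type} [RCLike K] {E : Type u} [AddCommGroup E] [Module K E]
    [TopologicalSpace E] (hE : IsWeaklyComplete K E) : T2Space E := by
  obtain ⟨J, ⟨e⟩⟩ := hE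
  exact e.toHomeomorph.symm.t2Space

theorem _root_.IsWeaklyComplete.continuousSMul {K : Type} [RCLike K] {E : Type u} [AddCommGroup E]
    [Module K E] [TopologicalSpace E] (hE : IsWeaklyComplete K E) : ContinuousSMul K E := by
  obtain ⟨J, ⟨e⟩⟩ := hE
  refine ⟨?_⟩
  rw [e.toHomeomorph.isInducing.continuous_iff]
  have : (e.toHomeomorph ∘ fun p : K × E => p.1 • p.2) = fun p => p.1 • e p.2 := by
    funext p; simp
  rw [this]
  fun_prop

section Algebra

variable {K : Type} [RCLike K] {A : Type u} [Ring A] [Algebra K A] [TopologicalSpace A]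
  [IsTopologicalRing A]

/-- For a continuous functional `φ` the form `φ (a * x)` factors through finitely many coordinates
of `x`. -/
theorem exists_finset_mul {J : Type u} (e : A ≃L[K] (J → K)) (φ : A →L[K] K) :
    ∃ F : Finset J, ∀ x : A, (∀ i ∈ F, e x i = 0) → ∀ a : A, φ (a * x) = 0 := by
  classical
  have hB : ContinuousAt (fun p : (J → K) × (J → K) => φ (e.symm p.1 * e.symm p.2)) (0, 0) := by
    fun_prop
  have hU := hB.preimage_mem_nhds (t := Metric.ball 0 1)
    (by simpa using Metric.ball_mem_nhds (0 : K) one_pos)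
  rw [nhds_prod_eq, Filter.mem_prod_iff] at hU
  obtain ⟨t₁, ht₁, t₂, ht₂, ht⟩ := hU
  obtain ⟨F₁, hF₁⟩ := exists_finset_of_nhds ht₁
  obtain ⟨F₂, hF₂⟩ := exists_finset_of_nhds ht₂
  have key : ∀ a x : A, (∀ i ∈ F₁, e a i = 0) → (∀ i ∈ F₂, e x i = 0) → φ (a * x) = 0 := by
    intro a x ha hx
    by_contra h
    have := ht (Set.mk_mem_prod (hF₁ ((φ (a * x))⁻¹ • e a) (fun i hi => by simp [ha i hi]))
      (hF₂ (e x) hx))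
    simp [h] at this
  let b : J → A := fun i => e.symm (Pi.single i 1)
  have h1 : ∀ i, ∃ F : Finset J, ∀ x : A, (∀ j ∈ F, e x j = 0) → φ (b i * x) = 0 := by
    intro i
    obtain ⟨F, hF⟩ := exists_finset_of_continuous
      ((φ : A →ₗ[K] K) ∘ₗ LinearMap.mulLeft K (b i) ∘ₗ (e.symm : (J → K) →ₗ[K] A))
      (by change Continuous fun y => φ (b i * e.symm y); fun_prop)
    exact ⟨F, fun x hx => by simpa using hF (e x) hx⟩
  choose G hG using h1
  refine ⟨F₂ ∪ F₁.biUnion G, fun x hx a => ?_⟩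
  have h2 := key (a - ∑ i ∈ F₁, e a i • b i) x (fun j hj => by
    simp [b, Finset.sum_apply, Pi.single_apply, hj]) (fun i hi => hx i (by simp [hi]))
  rw [sub_mul, map_sub, sub_eq_zero] at h2
  rw [h2, Finset.sum_mul, map_sum]
  refine Finset.sum_eq_zero fun i hi => ?_
  rw [smul_mul_assoc, map_smul, hG i x fun j hj => hx j ?_, smul_zero]
  exact Finset.mem_union_right _ (Finset.mem_biUnion.2 ⟨i, hi, hj⟩)

/-- Every continuous functional on a weakly complete unital algebra factors through a continuous
finite-dimensional matrix representation. -/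
theorem exists_matrix_rep (hA : IsWeaklyComplete K A) (φ : A →L[K] K) :
    ∃ (n : ℕ) (π : A →A[K] Matrix (Fin n) (Fin n) K) (ψ : Matrix (Fin n) (Fin n) K →ₗ[K] K),
      ∀ a, φ a = ψ (π a) := by
  classical
  obtain ⟨J, ⟨e⟩⟩ := hA
  obtain ⟨F, hF⟩ := exists_finset_mul e φ
  let L : Submodule A A :=
    { carrier := {x | ∀ a, φ (a * x) = 0}
      add_mem' := fun {x y} hx hy a => by rw [mul_add, map_add, hx a, hy a, add_zero]
      zero_mem' := fun a => by rw [mul_zero, map_zero]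
      smul_mem' := fun c x hx a => by rw [smul_eq_mul, ← mul_assoc]; exact hx _ }
  let q : A →ₗ[K] (A ⧸ L) := (L.mkQ).restrictScalars K
  have hq : Function.Surjective q := L.mkQ_surjective
  have hqF : ∀ x : A, (∀ i ∈ F, e x i = 0) → q x = 0 := fun x hx =>
    (Submodule.Quotient.mk_eq_zero L).2 (hF x hx)
  have hfin : FiniteDimensional K (A ⧸ L) := by
    refine Module.Finite.of_surjective
      (q ∘ₗ (e.symm : (J → K) →ₗ[K] A) ∘ₗ
        (LinearMap.pi fun j : J => if h : j ∈ F then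
          (LinearMap.proj (⟨j, h⟩ : F) : (F → K) →ₗ[K] K) else 0)) ?_
    intro y
    obtain ⟨x, rfl⟩ := hq y
    refine ⟨fun i => e x i, ?_⟩
    rw [← sub_eq_zero]
    simp only [LinearMap.comp_apply]
    rw [← map_sub]
    refine hqF _ fun i hi => ?_
    simp [hi]
  have hcont : ∀ c : (A ⧸ L) →ₗ[K] K, Continuous fun a => c (q a) := by
    intro c
    have := continuous_of_finset (c ∘ₗ q ∘ₗ (e.symm : (J → K) →ₗ[K] A)) F (fun x hx => by
      simp only [LinearMap.comp_apply]
      rw [hqF _ (fun i hi => by simpa using hx i hi), map_zero])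
    have h2 := this.comp e.continuous
    refine h2.congr fun a => ?_
    simp
  let b := Module.finBasis K (A ⧸ L)
  let π₀ : A →ₐ[K] Matrix _ _ K :=
    (LinearMap.toMatrixAlgEquiv b).toAlgHom.comp (Algebra.lsmul K K (A ⧸ L))
  have hπ₀ : Continuous π₀ := by
    refine continuous_pi fun i => continuous_pi fun j => ?_
    obtain ⟨x, hx⟩ := hq (b j)
    have : ∀ a, π₀ a i j = b.coord i (q (a * x)) := by
      intro a
      have h3 : q (a * x) = a • b j := by rw [← hx]; rfl
      rw [h3]
      simp [π₀, LinearMap.toMatrixAlgEquiv_apply]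
    simp only [this]
    exact (hcont (b.coord i)).comp (continuous_mul_const x)
  let φ' : (A ⧸ L) →ₗ[K] K := (L.restrictScalars K).liftQ (φ : A →ₗ[K] K) (fun x hx => by
    simpa using hx 1)
  refine ⟨_, ⟨π₀, hπ₀⟩, φ' ∘ₗ LinearMap.applyₗ (q 1) ∘ₗ
    (LinearMap.toMatrixAlgEquiv b).symm.toLinearMap, fun a => ?_⟩
  have h4 : φ a = φ' (q a) := rfl
  have h5 : q a = a • q 1 := by
    rw [show a • q 1 = q (a • 1) from rfl, smul_eq_mul, mul_one]
  rw [h4, h5]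
  simp [π₀]

end Algebra

/-- The canonical map of `A` into the product of matrix algebras over all of its continuous
finite-dimensional matrix representations. -/
def toMatrices (K : Type) [RCLike K] (A : Type u) [Ring A] [Algebra K A] [TopologicalSpace A] :
    A →A[K] ∀ σ : Σ n : ℕ, A →A[K] Matrix (Fin n) (Fin n) K, Matrix (Fin σ.1) (Fin σ.1) K where
  toFun a := fun σ => σ.2 a
  map_one' := funext fun σ => map_one σ.2
  map_mul' a b := funext fun σ => map_mul σ.2 a b
  map_zero' := funext fun σ => map_zero σ.2
  map_add' a b := funext fun σ => map_add σ.2 a b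
  commutes' r := funext fun σ => AlgHomClass.commutes σ.2 r
  cont := continuous_pi fun σ => σ.2.continuous

section

variable {K : Type} [RCLike K] {A : Type u} [Ring A] [Algebra K A] [TopologicalSpace A]
  [IsTopologicalRing A]

theorem isInducing_toMatrices (hA : IsWeaklyComplete K A) : IsInducing (toMatrices K A) := by
  have hA' := hA
  obtain ⟨J, ⟨e⟩⟩ := hA'
  choose n π ψ h using fun j : J =>
    exists_matrix_rep hA ((ContinuousLinearMap.proj j : (J → K) →L[K] K).comp (e : A →L[K] (J → K)))
  have hψ : ∀ j, Continuous (ψ j) := fun j => LinearMap.continuous_of_finiteDimensional _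
  refine IsInducing.of_comp (toMatrices K A).continuous
    (g := fun M j => ψ j (M ⟨n j, π j⟩)) (by fun_prop) ?_
  convert! e.toHomeomorph.isInducing using 1
  funext a j
  exact (h j a).symm

theorem injective_toMatrices (hA : IsWeaklyComplete K A) : Function.Injective (toMatrices K A) :=
  have := hA.t2Space
  (isInducing_toMatrices hA).injective

theorem isClosed_range_toMatrices (hA : IsWeaklyComplete K A) :
    IsClosed (Set.range (toMatrices K A)) :=
  hA.isClosed_range (toMatrices K A).toAlgHom.toRingHom.toAddMonoidHom (isInducing_toMatrices hA)

end

end WeaklyCompleteAux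

section ProfiniteDimensional

variable (K : Type) [RCLike K] (L : Type u) [LieRing L] [LieAlgebra K L] [TopologicalSpace L]

/-- The closed ideals `I` of a topological Lie algebra `L` such that `L / I` is
finite-dimensional. -/
def CofiniteIdeal : Type u :=
  {I : LieIdeal K L // IsClosed (I : Set L) ∧ FiniteDimensional K (L ⧸ I.toSubmodule)}

/-- The projective limit of the finite-dimensional quotients `L / I`, where each `L / I` has
the quotient topology, as a subspace of the product of all `L / I`. -/
def CofiniteLimit : Type u :=
  {x : ∀ I : CofiniteIdeal K L, L ⧸ I.1.toSubmodule //
    ∀ (I J : CofiniteIdeal K L) (h : J.1.toSubmodule ≤ I.1.toSubmodule),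
      Submodule.factor h (x J) = x I}

instance : TopologicalSpace (CofiniteLimit K L) :=
  inferInstanceAs (TopologicalSpace {x : ∀ I : CofiniteIdeal K L, L ⧸ I.1.toSubmodule //
    ∀ (I J : CofiniteIdeal K L) (h : J.1.toSubmodule ≤ I.1.toSubmodule),
      Submodule.factor h (x J) = x I})

/-- The canonical map `x ↦ (x + I)_I` from `L` to the projective limit. -/
def toCofiniteLimit (x : L) : CofiniteLimit K L :=
  ⟨fun I => Submodule.mkQ I.1.toSubmodule x, fun _ _ _ => rfl⟩

/-- A topological Lie algebra is profinite-dimensional if it is, algebraically and topologically,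
the projective limit of its finite-dimensional quotients by closed ideals: the canonical map
(which preserves all algebraic operations, these being defined componentwise) is a
homeomorphism. -/
def IsProfiniteDimensional : Prop :=
  IsHomeomorph (toCofiniteLimit K L)

end ProfiniteDimensional

namespace WeaklyCompleteAux

section

variable {K : Type} [RCLike K] {A : Type u} [Ring A] [Algebra K A] [TopologicalSpace A]
  [IsTopologicalRing A]

/-- The underlying Lie algebra of a weakly complete unital algebra is profinite-dimensional. -/
theorem isProfiniteDimensional (hA : IsWeaklyComplete K A) : IsProfiniteDimensional K A := by
  classical
  have := hA.t2Space
  have hA' := hA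
  obtain ⟨J, ⟨e⟩⟩ := hA'
  have hcont : Continuous (toCofiniteLimit K A) :=
    Continuous.subtype_mk (continuous_pi fun I => continuous_quot_mk) _
  have hI : ∀ j : J, ∃ (I : CofiniteIdeal K A) (ψ : (A ⧸ I.1.toSubmodule) → K), Continuous ψ ∧
      ∀ a, e a j = ψ (Submodule.mkQ I.1.toSubmodule a) := by
    intro j
    obtain ⟨n, π, ψ, h⟩ := exists_matrix_rep hA
      ((ContinuousLinearMap.proj j : (J → K) →L[K] K).comp (e : A →L[K] (J → K)))
    let πl : A →ₗ[K] Matrix (Fin n) (Fin n) K := π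
    let I : LieIdeal K A :=
      { LinearMap.ker πl with
        lie_mem := fun {x m} hm => by
          have hm' : π m = 0 := hm
          change π ⁅x, m⁆ = 0
          rw [Ring.lie_def, map_sub, map_mul, map_mul, hm', mul_zero, zero_mul, sub_zero] }
    have hIker : I.toSubmodule = LinearMap.ker πl := rfl
    have hclosed : IsClosed (I : Set A) := by
      have : (I : Set A) = π ⁻¹' {0} := rfl
      rw [this]
      exact isClosed_singleton.preimage π.continuous
    have hfin : FiniteDimensional K (A ⧸ I.toSubmodule) :=
      Module.Finite.equiv πl.quotKerEquivRange.symm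
    refine ⟨⟨I, hclosed, hfin⟩, fun y => ψ (Submodule.liftQ I.toSubmodule πl hIker.le y), ?_, ?_⟩
    · refine (LinearMap.continuous_of_finiteDimensional ψ).comp ?_
      exact continuous_quot_lift _ π.continuous
    · intro a
      exact h a
  choose I ψ hψ h using hI
  have hind' : IsInducing fun (a : A) (I : CofiniteIdeal K A) => Submodule.mkQ I.1.toSubmodule a := by
    refine IsInducing.of_comp (continuous_pi fun I => continuous_quot_mk)
      (g := fun x j => ψ j (x (I j))) (by fun_prop) ?_
    convert! e.toHomeomorph.isInducing using 1
    funext a j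
    exact (h j a).symm
  have hind : IsInducing (toCofiniteLimit K A) :=
    IsInducing.of_comp hcont continuous_subtype_val hind'
  have hsurj : Function.Surjective (toCofiniteLimit K A) := by
    intro y
    have ht : ∀ I : CofiniteIdeal K A, T2Space (A ⧸ I.1.toSubmodule) := fun I =>
      have : IsClosed (I.1.toSubmodule : Set A) := I.2.1
      inferInstance
    let f : A →+ ∀ I : CofiniteIdeal K A, A ⧸ I.1.toSubmodule :=
      { toFun := fun a I => Submodule.mkQ I.1.toSubmodule a
        map_zero' := rfl
        map_add' := fun _ _ => rfl }
    obtain ⟨a, ha⟩ := hA.mem_range_of_finset f hind' y.1 (fun s => by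
      have hs : ∃ M : CofiniteIdeal K A, ∀ I ∈ s, M.1.toSubmodule ≤ I.1.toSubmodule := by
        induction s using Finset.induction_on with
        | empty =>
          exact ⟨⟨⊤, isClosed_univ, by
            have : Subsingleton (A ⧸ (⊤ : LieIdeal K A).toSubmodule) :=
              Submodule.Quotient.subsingleton_iff.2 rfl
            infer_instance⟩, by simp⟩
        | insert I s _ ih =>
          obtain ⟨M, hM⟩ := ih
          have h1 : I.1.toSubmodule.CoFG := I.2.2
          have h2 : M.1.toSubmodule.CoFG := M.2.2
          refine ⟨⟨I.1 ⊓ M.1, I.2.1.inter M.2.1, ?_⟩, fun N hN => ?_⟩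
          · exact h1.inf h2
          · rcases Finset.mem_insert.1 hN with rfl | hN
            · exact inf_le_left
            · exact inf_le_right.trans (hM N hN)
      obtain ⟨M, hM⟩ := hs
      obtain ⟨a, ha⟩ := Submodule.mkQ_surjective _ (y.1 M)
      refine ⟨a, fun I hI => ?_⟩
      rw [← y.2 I M (hM I hI), ← ha]
      rfl)
    exact ⟨a, Subtype.ext ha⟩
  have hinj : Function.Injective (toCofiniteLimit K A) := by
    intro a b hab
    have : T0Space A := inferInstance
    exact hind.injective hab
  exact isHomeomorph_iff_isEmbedding_surjective.2 ⟨⟨hind, hinj⟩, hsurj⟩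

end

end WeaklyCompleteAux

variable (K : Type) [RCLike K]

/-- The objects of the category of profinite-dimensional topological Lie algebras over `K`. -/
structure ProfiniteLie where
  carrier : Type u
  [lieRing : LieRing carrier]
  [lieAlgebra : LieAlgebra K carrier]
  [topologicalSpace : TopologicalSpace carrier]
  [isTopologicalAddGroup : IsTopologicalAddGroup carrier]
  [continuousSMul : ContinuousSMul K carrier]
  continuous_bracket : Continuous fun p : carrier × carrier => ⁅p.1, p.2⁆
  isProfiniteDimensional : IsProfiniteDimensional K carrier

/-- The objects of the category of weakly complete associative unital algebras over `K`. -/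
structure WeaklyCompleteAlg where
  carrier : Type u
  [ring : Ring carrier]
  [algebra : Algebra K carrier]
  [topologicalSpace : TopologicalSpace carrier]
  [isTopologicalRing : IsTopologicalRing carrier]
  isWeaklyComplete : IsWeaklyComplete K carrier

variable {K}

attribute [instance] ProfiniteLie.lieRing ProfiniteLie.lieAlgebra ProfiniteLie.topologicalSpace
  ProfiniteLie.isTopologicalAddGroup ProfiniteLie.continuousSMul
  WeaklyCompleteAlg.ring WeaklyCompleteAlg.algebra WeaklyCompleteAlg.topologicalSpace
  WeaklyCompleteAlg.isTopologicalRing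

instance : CoeSort (ProfiniteLie.{u} K) (Type u) := ⟨ProfiniteLie.carrier⟩

instance : CoeSort (WeaklyCompleteAlg.{u} K) (Type u) := ⟨WeaklyCompleteAlg.carrier⟩

/-- Morphisms of topological Lie algebras: continuous Lie algebra homomorphisms. -/
@[ext]
structure ContinuousLieHom (K : Type) [RCLike K] (L M : Type*) [LieRing L] [LieAlgebra K L]
    [TopologicalSpace L] [LieRing M] [LieAlgebra K M] [TopologicalSpace M] where
  toLieHom : L →ₗ⁅K⁆ M
  continuous_toLieHom : Continuous toLieHom

/-- Morphisms are the continuous Lie algebra homomorphisms. -/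
instance : Category (ProfiniteLie.{u} K) where
  Hom L M := ContinuousLieHom K L M
  id L := ⟨LieHom.id, continuous_id⟩
  comp f g := ⟨g.toLieHom.comp f.toLieHom, g.continuous_toLieHom.comp f.continuous_toLieHom⟩

/-- Morphisms are the continuous unital algebra homomorphisms. -/
instance : Category (WeaklyCompleteAlg.{u} K) where
  Hom A B := A →A[K] B
  id A := ContinuousAlgHom.id K A
  comp f g := ContinuousAlgHom.comp g f

variable (K)

/-- The underlying Lie algebra functor, which equips a weakly complete unital algebra with the
commutator bracket. -/
def lieFunctor : WeaklyCompleteAlg.{u} K ⥤ ProfiniteLie.{u} K where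
  obj A :=
    { carrier := A
      continuousSMul := A.isWeaklyComplete.continuousSMul
      continuous_bracket := by
        simp only [Ring.lie_def]
        fun_prop
      isProfiniteDimensional := WeaklyCompleteAux.isProfiniteDimensional A.isWeaklyComplete }
  map f := ⟨AlgHom.toLieHom (f : _ →A[K] _).toAlgHom, (f : _ →A[K] _).cont⟩

variable {K}

/-- The continuous finite-dimensional matrix representations of a topological Lie algebra. -/
def MatrixRep (L : ProfiniteLie.{u} K) : Type u :=
  Σ n : ℕ, ContinuousLieHom K L (Matrix (Fin n) (Fin n) K)

/-- The product of the matrix algebras over all continuous matrix representations of `L`. -/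
abbrev MatrixProduct (L : ProfiniteLie.{u} K) : Type u :=
  ∀ ρ : MatrixRep L, Matrix (Fin ρ.1) (Fin ρ.1) K

/-- The image of `x` under all continuous matrix representations. -/
def toMatrixProduct (L : ProfiniteLie.{u} K) (x : L) : MatrixProduct L :=
  fun ρ => ρ.2.toLieHom x

/-- The closed unital subalgebra generated by `L` in the product of the matrix algebras of all its
continuous finite-dimensional matrix representations. -/
def envelopingSubalgebra (L : ProfiniteLie.{u} K) : Subalgebra K (MatrixProduct L) :=
  (Algebra.adjoin K (Set.range (toMatrixProduct L))).topologicalClosure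

theorem toMatrixProduct_mem (L : ProfiniteLie.{u} K) (x : L) :
    toMatrixProduct L x ∈ envelopingSubalgebra L :=
  Subalgebra.le_topologicalClosure _ (Algebra.subset_adjoin ⟨x, rfl⟩)

theorem isWeaklyComplete_envelopingSubalgebra (L : ProfiniteLie.{u} K) :
    IsWeaklyComplete K (envelopingSubalgebra L) := by
  let e : MatrixProduct L ≃L[K] ((Σ ρ : MatrixRep L, Fin ρ.1 × Fin ρ.1) → K) :=
    { toFun := fun M p => M p.1 p.2.1 p.2.2
      invFun := fun v ρ i j => v ⟨ρ, i, j⟩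
      map_add' := fun _ _ => rfl
      map_smul' := fun _ _ => rfl
      left_inv := fun _ => rfl
      right_inv := fun _ => rfl
      continuous_toFun := by
        refine continuous_pi fun p => ?_
        exact ((continuous_apply p.1).matrix_elem p.2.1 p.2.2)
      continuous_invFun := continuous_pi fun ρ => continuous_pi fun i => continuous_pi fun j =>
        continuous_apply _ }
  let S : Submodule K ((Σ ρ : MatrixRep L, Fin ρ.1 × Fin ρ.1) → K) :=
    (envelopingSubalgebra L).toSubmodule.map (e : MatrixProduct L →ₗ[K] _)
  have hS : IsClosed (S : Set ((Σ ρ : MatrixRep L, Fin ρ.1 × Fin ρ.1) → K)) :=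
    e.toHomeomorph.isClosedMap _ (Subalgebra.isClosed_topologicalClosure _)
  exact (WeaklyCompleteAux.isWeaklyComplete_of_isClosed S hS).of_equiv
    (e.submoduleMap (envelopingSubalgebra L).toSubmodule)

/-- The weakly complete enveloping algebra of a profinite-dimensional Lie algebra. -/
def envelopingObj (L : ProfiniteLie.{u} K) : WeaklyCompleteAlg.{u} K where
  carrier := envelopingSubalgebra L
  isTopologicalRing := (envelopingSubalgebra L).toSubring.instIsTopologicalRing
  isWeaklyComplete := isWeaklyComplete_envelopingSubalgebra L

/-- The canonical morphism of `L` into its weakly complete enveloping algebra. -/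
def toEnvelopingObj (L : ProfiniteLie.{u} K) : L ⟶ (lieFunctor K).obj (envelopingObj L) :=
  let f : ContinuousLieHom K L (envelopingSubalgebra L) :=
    { toLieHom :=
        { toFun := fun x => ⟨toMatrixProduct L x, toMatrixProduct_mem L x⟩
          map_add' := fun x y => Subtype.ext (funext fun ρ => map_add ρ.2.toLieHom x y)
          map_smul' := fun c x => Subtype.ext (funext fun ρ => map_smul ρ.2.toLieHom c x)
          map_lie' := fun {x y} => Subtype.ext (funext fun ρ => LieHom.map_lie ρ.2.toLieHom x y) }
      continuous_toLieHom :=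
        Continuous.subtype_mk (continuous_pi fun ρ => ρ.2.continuous_toLieHom) _ }
  f

theorem envelopingObj_hom_ext {L : ProfiniteLie.{u} K} {A : WeaklyCompleteAlg.{u} K}
    (f g : envelopingObj L ⟶ A)
    (h : toEnvelopingObj L ≫ (lieFunctor K).map f = toEnvelopingObj L ≫ (lieFunctor K).map g) :
    f = g := by
  have := A.isWeaklyComplete.t2Space
  let f₀ : envelopingSubalgebra L →A[K] A := f
  let g₀ : envelopingSubalgebra L →A[K] A := g
  have h₀ : ∀ x : L, f₀ ⟨toMatrixProduct L x, toMatrixProduct_mem L x⟩ =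
      g₀ ⟨toMatrixProduct L x, toMatrixProduct_mem L x⟩ := fun x =>
    congrArg (fun k : ContinuousLieHom K L A => k.toLieHom x) h
  let T := (AlgHom.equalizer (f₀ : _ →ₐ[K] A) (g₀ : _ →ₐ[K] A)).map (envelopingSubalgebra L).val
  have hT : IsClosed (T : Set (MatrixProduct L)) :=
    (Subalgebra.isClosed_topologicalClosure _).isClosedEmbedding_subtypeVal.isClosedMap _
      (isClosed_eq f₀.continuous g₀.continuous)
  have hle : envelopingSubalgebra L ≤ T := by
    refine Subalgebra.topologicalClosure_minimal (Algebra.adjoin_le ?_) hT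
    rintro _ ⟨x, rfl⟩
    exact ⟨⟨toMatrixProduct L x, toMatrixProduct_mem L x⟩, h₀ x, rfl⟩
  have : f₀ = g₀ := by
    ext x
    obtain ⟨y, hy, hyx⟩ := hle x.2
    have : y = x := Subtype.ext hyx
    rw [← this]
    exact hy
  exact this

theorem exists_envelopingObj_hom {L : ProfiniteLie.{u} K} {A : WeaklyCompleteAlg.{u} K}
    (f : L ⟶ (lieFunctor K).obj A) :
    ∃ f' : envelopingObj L ⟶ A, toEnvelopingObj L ≫ (lieFunctor K).map f' = f := by
  let f₀ : ContinuousLieHom K L A := f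
  let ι := WeaklyCompleteAux.toMatrices K A
  have hind : IsInducing ι := WeaklyCompleteAux.isInducing_toMatrices A.isWeaklyComplete
  have hinj : Function.Injective ι := WeaklyCompleteAux.injective_toMatrices A.isWeaklyComplete
  have hcl : IsClosed (Set.range ι) := WeaklyCompleteAux.isClosed_range_toMatrices A.isWeaklyComplete
  let r : (Σ n : ℕ, A →A[K] Matrix (Fin n) (Fin n) K) → MatrixRep L := fun σ =>
    ⟨σ.1, (AlgHom.toLieHom σ.2.toAlgHom).comp f₀.toLieHom,
      σ.2.continuous.comp f₀.continuous_toLieHom⟩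
  let Φ : MatrixProduct L →ₐ[K]
      (∀ σ : Σ n : ℕ, A →A[K] Matrix (Fin n) (Fin n) K, Matrix (Fin σ.1) (Fin σ.1) K) :=
    AlgHom.pi fun σ => Pi.evalAlgHom K _ (r σ)
  have hΦ : Continuous Φ := continuous_pi fun σ => continuous_apply (r σ)
  have hΦf : ∀ x : L, Φ (toMatrixProduct L x) = ι (f₀.toLieHom x) := fun x => rfl
  have hle : envelopingSubalgebra L ≤ (ι.toAlgHom.range).comap Φ := by
    refine Subalgebra.topologicalClosure_minimal (Algebra.adjoin_le ?_) (hcl.preimage hΦ)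
    rintro _ ⟨x, rfl⟩
    exact ⟨f₀.toLieHom x, (hΦf x).symm⟩
  let E : A ≃ₐ[K] ι.toAlgHom.range := AlgEquiv.ofInjective ι.toAlgHom hinj
  let g : envelopingSubalgebra L →ₐ[K] A :=
    E.symm.toAlgHom.comp
      ((Φ.comp (envelopingSubalgebra L).val).codRestrict ι.toAlgHom.range fun x => hle x.2)
  have hg : ∀ x, ι (g x) = Φ x := fun x =>
    congrArg Subtype.val (E.apply_symm_apply ⟨Φ x, hle x.2⟩)
  have hgc : Continuous g := by
    rw [hind.continuous_iff]
    exact (hΦ.comp continuous_subtype_val).congr fun x => (hg x).symm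
  let g' : envelopingSubalgebra L →A[K] A := ⟨g, hgc⟩
  refine ⟨g', ?_⟩
  refine ContinuousLieHom.ext (LieHom.ext fun x => hinj ?_)
  exact hg ⟨toMatrixProduct L x, toMatrixProduct_mem L x⟩

/-- The universal property as a bijection between sets of morphisms. -/
noncomputable def envelopingEquiv (L : ProfiniteLie.{u} K) (A : WeaklyCompleteAlg.{u} K) :
    (envelopingObj L ⟶ A) ≃ (L ⟶ (lieFunctor K).obj A) :=
  Equiv.ofBijective (fun f' => toEnvelopingObj L ≫ (lieFunctor K).map f')
    ⟨fun f g h => envelopingObj_hom_ext f g h, exists_envelopingObj_hom⟩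

theorem envelopingEquiv_comp (L : ProfiniteLie.{u} K) (A B : WeaklyCompleteAlg.{u} K) (g : A ⟶ B)
    (h : envelopingObj L ⟶ A) :
    envelopingEquiv L B (h ≫ g) = envelopingEquiv L A h ≫ (lieFunctor K).map g := by
  change toEnvelopingObj L ≫ (lieFunctor K).map (h ≫ g) =
    (toEnvelopingObj L ≫ (lieFunctor K).map h) ≫ (lieFunctor K).map g
  rw [CategoryTheory.Functor.map_comp, Category.assoc]

variable (K)

/-- The weakly complete enveloping algebra functor. -/
noncomputable def envelopingFunctor : ProfiniteLie.{u} K ⥤ WeaklyCompleteAlg.{u} K :=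
  Adjunction.leftAdjointOfEquiv (G := lieFunctor K) (F_obj := envelopingObj) envelopingEquiv
    envelopingEquiv_comp

/-- The weakly complete enveloping algebra functor is left adjoint to the underlying Lie algebra
functor. -/
noncomputable def envelopingAdjunction : envelopingFunctor.{u} K ⊣ lieFunctor.{u} K :=
  Adjunction.adjunctionOfEquivLeft envelopingEquiv envelopingEquiv_comp

theorem envelopingAdjunction_unit_app (L : ProfiniteLie.{u} K) :
    (envelopingAdjunction K).unit.app L = toEnvelopingObj L := by
  change envelopingEquiv L (envelopingObj L) (𝟙 _) = _
  change toEnvelopingObj L ≫ (lieFunctor K).map (𝟙 _) = _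
  rw [CategoryTheory.Functor.map_id, Category.comp_id]

variable {K}

/-- For a morphism `j` of `L` into the underlying Lie algebra of `W`: every morphism of `L` into
the underlying Lie algebra of `A` extends uniquely along `j` to a morphism of weakly complete
unital algebras from `W` to `A`. -/
def ExtendsUniquely {L : ProfiniteLie.{u} K} {W : WeaklyCompleteAlg.{u} K}
    (j : L ⟶ (lieFunctor K).obj W) (A : WeaklyCompleteAlg.{u} K) : Prop :=
  ∀ f : L ⟶ (lieFunctor K).obj A, ∃! f' : W ⟶ A, j ≫ (lieFunctor K).map f' = f

/-! A weakly complete algebra `A` is the projective limit of finite-dimensional algebras, so a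
universal property tested on finite-dimensional targets passes to all targets. Continuous matrix
representations induce the topology of `A` and separate its points; for a finite set `s` of them,
let `A_s` be the image of `A` in the corresponding finite product of matrix algebras. Since `A` is
complete, its image in the full product is closed, so every compatible family of morphisms into the
`A_s` lifts to `A` (`exists_lift_of_finiteImage`), and the lift is unique
(`hom_ext_of_toFiniteImage`).

Given `f` from `L` to `A`, the hypothesis extends each composite of `f` with the projection to
`A_s`. Uniqueness in the finite-dimensional case makes these extensions compatible, and their lift
is the required extension of `f` (`ExtendsUniquely.of_finiteDimensional`). Now `W` and the
enveloping algebra solve the same universal problem, hence are uniquely isomorphic; for a functor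
`V` the isomorphisms are natural because both sides of each naturality square agree along `ν`. -/

theorem isWeaklyComplete_of_finiteDimensional (K : Type) [RCLike K] (E : Type u) [AddCommGroup E]
    [Module K E] [TopologicalSpace E] [IsTopologicalAddGroup E] [ContinuousSMul K E] [T2Space E]
    [FiniteDimensional K E] : IsWeaklyComplete K E :=
  -- `ULift` places the index set in the universe required by `IsWeaklyComplete`. Continuity in both
  -- directions is automatic in finite dimension.
  ⟨ULift.{u} (Fin (Module.finrank K E)),
    ⟨((Module.finBasis K E).equivFun ≪≫ₗ
      LinearEquiv.funCongrLeft K K Equiv.ulift).toContinuousLinearEquiv⟩⟩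

/-! ### Weakly complete algebras as projective limits of finite-dimensional images -/

section FiniteQuotients

variable {K : Type} [RCLike K] (A : WeaklyCompleteAlg.{u} K)
  (s : Finset (Σ n : ℕ, A →A[K] Matrix (Fin n) (Fin n) K))

/-- The map of `A` into the product of the matrix algebras over finitely many of its continuous
finite-dimensional matrix representations. -/
def WeaklyCompleteAlg.toFiniteMatrices :
    A →ₐ[K] (∀ σ : s, Matrix (Fin σ.1.1) (Fin σ.1.1) K) :=
  AlgHom.pi fun σ => (σ.1.2 : A →ₐ[K] Matrix (Fin σ.1.1) (Fin σ.1.1) K)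

instance : FiniteDimensional K (A.toFiniteMatrices s).range :=
  inferInstanceAs (FiniteDimensional K (Subalgebra.toSubmodule (A.toFiniteMatrices s).range))

/-- The image of `A` in the product of the matrix algebras over finitely many of its continuous
finite-dimensional matrix representations, as a finite-dimensional weakly complete algebra. -/
def WeaklyCompleteAlg.finiteImage : WeaklyCompleteAlg.{u} K where
  carrier := (A.toFiniteMatrices s).range
  isTopologicalRing := (A.toFiniteMatrices s).range.toSubring.instIsTopologicalRing
  isWeaklyComplete := by
    have : IsTopologicalRing (A.toFiniteMatrices s).range :=
      (A.toFiniteMatrices s).range.toSubring.instIsTopologicalRing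
    have : ContinuousSMul K (A.toFiniteMatrices s).range :=
      inferInstanceAs (ContinuousSMul K (Subalgebra.toSubmodule (A.toFiniteMatrices s).range))
    exact isWeaklyComplete_of_finiteDimensional K _

instance : FiniteDimensional K (A.finiteImage s) :=
  inferInstanceAs (FiniteDimensional K (A.toFiniteMatrices s).range)

/-- The projection of `A` onto one of its finite-dimensional images. -/
def WeaklyCompleteAlg.toFiniteImage : A ⟶ A.finiteImage s :=
  let f : A →A[K] (A.toFiniteMatrices s).range :=
    ⟨(A.toFiniteMatrices s).rangeRestrict,
      Continuous.subtype_mk (continuous_pi fun σ => σ.1.2.continuous) _⟩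
  f

variable {A s} in
-- A point of the larger image comes from a single `a : A`, and the same `a` witnesses the
-- restriction; this makes the transition maps well defined.
theorem WeaklyCompleteAlg.restrict_mem_range
    {t : Finset (Σ n : ℕ, A →A[K] Matrix (Fin n) (Fin n) K)} (h : s ⊆ t)
    (x : (A.toFiniteMatrices t).range) :
    (fun σ : s => x.1 ⟨σ.1, h σ.2⟩) ∈ (A.toFiniteMatrices s).range := by
  obtain ⟨_, a, rfl⟩ := x
  exact ⟨a, rfl⟩

variable {A s} in
/-- The projection between finite-dimensional images of `A` given by an inclusion of sets of
matrix representations. -/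
def WeaklyCompleteAlg.finiteImageMap
    {t : Finset (Σ n : ℕ, A →A[K] Matrix (Fin n) (Fin n) K)} (h : s ⊆ t) :
    A.finiteImage t ⟶ A.finiteImage s :=
  let f : (A.toFiniteMatrices t).range →A[K] (A.toFiniteMatrices s).range :=
    ⟨((AlgHom.pi fun σ : s => Pi.evalAlgHom K
        (fun σ : t => Matrix (Fin σ.1.1) (Fin σ.1.1) K) ⟨σ.1, h σ.2⟩).comp
        (A.toFiniteMatrices t).range.val).codRestrict _ (restrict_mem_range h),
      Continuous.subtype_mk
        (continuous_pi fun σ => (continuous_apply (⟨σ.1, h σ.2⟩ : t)).comp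
          continuous_subtype_val) _⟩
  f

variable {A s} in
theorem WeaklyCompleteAlg.toFiniteImage_comp_finiteImageMap
    {t : Finset (Σ n : ℕ, A →A[K] Matrix (Fin n) (Fin n) K)} (h : s ⊆ t) :
    A.toFiniteImage t ≫ finiteImageMap h = A.toFiniteImage s :=
  rfl

variable {A} in
-- Singletons `s = {σ}` already suffice, because the matrix representations of `A` separate points.
theorem WeaklyCompleteAlg.hom_ext_of_toFiniteImage {W : WeaklyCompleteAlg.{u} K} {f g : W ⟶ A}
    (h : ∀ s, f ≫ A.toFiniteImage s = g ≫ A.toFiniteImage s) : f = g := by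
  let f₀ : W →A[K] A := f
  let g₀ : W →A[K] A := g
  have : f₀ = g₀ := by
    ext w
    refine WeaklyCompleteAux.injective_toMatrices A.isWeaklyComplete (funext fun σ => ?_)
    have h1 := congrArg (fun k : W →A[K] (A.toFiniteMatrices {σ}).range => (k w).1) (h {σ})
    exact congrFun h1 ⟨σ, Finset.mem_singleton_self σ⟩
  exact this

variable {A} in
/-- A weakly complete algebra is the projective limit of its finite-dimensional images: compatible
families of morphisms lift. -/
theorem WeaklyCompleteAlg.exists_lift_of_finiteImage {W : WeaklyCompleteAlg.{u} K}
    (g : ∀ s, W ⟶ A.finiteImage s)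
    (hg : ∀ s t (h : s ⊆ t), g t ≫ finiteImageMap h = g s) :
    ∃ f : W ⟶ A, ∀ s, f ≫ A.toFiniteImage s = g s := by
  let g₀ : ∀ s, W →A[K] (A.toFiniteMatrices s).range := g
  let ι := WeaklyCompleteAux.toMatrices K A
  have hind : IsInducing ι := WeaklyCompleteAux.isInducing_toMatrices A.isWeaklyComplete
  have hinj : Function.Injective ι := WeaklyCompleteAux.injective_toMatrices A.isWeaklyComplete
  -- The candidate in the full product: its coordinate at `σ` is read off from `g {σ}`.
  let Φ : W →ₐ[K]
      (∀ σ : Σ n : ℕ, A →A[K] Matrix (Fin n) (Fin n) K, Matrix (Fin σ.1) (Fin σ.1) K) :=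
    AlgHom.pi fun σ => (Pi.evalAlgHom K
      (fun τ : ({σ} : Finset (Σ n : ℕ, A →A[K] Matrix (Fin n) (Fin n) K)) =>
        Matrix (Fin τ.1.1) (Fin τ.1.1) K) ⟨σ, Finset.mem_singleton_self σ⟩).comp
      ((A.toFiniteMatrices {σ}).range.val.comp (g₀ {σ} : W →ₐ[K] _))
  have hΦc : Continuous Φ := continuous_pi fun σ =>
    (continuous_apply (⟨σ, Finset.mem_singleton_self σ⟩ :
      ({σ} : Finset (Σ n : ℕ, A →A[K] Matrix (Fin n) (Fin n) K)))).comp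
      (continuous_subtype_val.comp (g₀ {σ}).continuous)
  -- Compatibility along `{σ} ⊆ s` shows that the singletons determine every `g s`.
  have hΦ : ∀ (s : Finset (Σ n : ℕ, A →A[K] Matrix (Fin n) (Fin n) K)) (w : W) (σ : s),
      Φ w σ.1 = (g₀ s w).1 σ := by
    intro s w σ
    have h1 := congrArg (fun k : W →A[K] (A.toFiniteMatrices {σ.1}).range => (k w).1)
      (hg _ _ (Finset.singleton_subset_iff.2 σ.2))
    exact (congrFun h1 ⟨σ.1, Finset.mem_singleton_self σ.1⟩).symm
  -- Completeness enters here. On each finite `s` the tuple `Φ w` agrees with `ι a` for some `a`, so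
  -- `Φ w` lies in the closure of the image of `ι`, which is closed.
  have hmem : ∀ w, Φ w ∈ ι.toAlgHom.range := by
    intro w
    refine A.isWeaklyComplete.mem_range_of_finset ι.toAlgHom.toRingHom.toAddMonoidHom hind (Φ w)
      fun s => ?_
    obtain ⟨a, ha⟩ := (g₀ s w).2
    exact ⟨a, fun σ hσ => (congrFun ha ⟨σ, hσ⟩).trans (hΦ s w ⟨σ, hσ⟩).symm⟩
  let E : A ≃ₐ[K] ι.toAlgHom.range := AlgEquiv.ofInjective ι.toAlgHom hinj
  let f : W →ₐ[K] A := E.symm.toAlgHom.comp (Φ.codRestrict ι.toAlgHom.range hmem)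
  have hf : ∀ w, ι (f w) = Φ w := fun w =>
    congrArg Subtype.val (E.apply_symm_apply ⟨Φ w, hmem w⟩)
  -- As `ι` is inducing, continuity of `f` reduces to that of `ι ∘ f = Φ`.
  have hfc : Continuous f := by
    rw [hind.continuous_iff]
    exact hΦc.congr fun w => (hf w).symm
  let f' : W →A[K] A := ⟨f, hfc⟩
  refine ⟨f', fun s => ?_⟩
  refine ContinuousAlgHom.ext fun w => Subtype.ext (funext fun σ => ?_)
  exact (congrFun (hf w) σ.1).trans (hΦ s w σ)

end FiniteQuotients

/-! ### From finite-dimensional targets to all targets, and uniqueness of solutions -/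

section UniversalProperty

variable {K : Type} [RCLike K] {L : ProfiniteLie.{u} K} {W : WeaklyCompleteAlg.{u} K}
  {j : L ⟶ (lieFunctor K).obj W}

/-- The uniqueness half as a cancellation rule: `j` acts like an epimorphism towards `A`. -/
theorem ExtendsUniquely.hom_ext {A : WeaklyCompleteAlg.{u} K} (h : ExtendsUniquely j A)
    {f g : W ⟶ A} (hfg : j ≫ (lieFunctor K).map f = j ≫ (lieFunctor K).map g) : f = g :=
  (h _).unique hfg rfl

/-- The universal property for finite-dimensional algebras implies it for all weakly complete
algebras. -/
theorem ExtendsUniquely.of_finiteDimensional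
    (h : ∀ A : WeaklyCompleteAlg.{u} K, FiniteDimensional K A → ExtendsUniquely j A)
    (A : WeaklyCompleteAlg.{u} K) : ExtendsUniquely j A := by
  intro f
  have hs := fun s => h (A.finiteImage s) inferInstance
  choose g hg _ using fun s => hs s (f ≫ (lieFunctor K).map (A.toFiniteImage s))
  -- Both `g s` and `g t` followed by the transition map restrict along `j` to `f` followed by the
  -- projection to the image for `s`, so uniqueness there identifies them.
  obtain ⟨f', hf'⟩ := WeaklyCompleteAlg.exists_lift_of_finiteImage g fun s t hst =>
    (hs s).hom_ext (by
      rw [Functor.map_comp, reassoc_of% hg t, ← Functor.map_comp,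
        WeaklyCompleteAlg.toFiniteImage_comp_finiteImageMap]
      exact (hg s).symm)
  refine ⟨f', ?_, fun f'' hf'' => ?_⟩
  -- These are Lie morphisms out of `L`, so `hom_ext_of_toFiniteImage` does not apply; equality is
  -- tested on one matrix representation at a time.
  · refine ContinuousLieHom.ext (LieHom.ext fun x => ?_)
    refine WeaklyCompleteAux.injective_toMatrices A.isWeaklyComplete (funext fun σ => ?_)
    have h1 : j ≫ (lieFunctor K).map f' ≫ (lieFunctor K).map (A.toFiniteImage {σ}) =
        f ≫ (lieFunctor K).map (A.toFiniteImage {σ}) := by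
      rw [← Functor.map_comp, hf', hg]
    have h2 := congrArg (fun k : ContinuousLieHom K L (A.toFiniteMatrices {σ}).range =>
      k.toLieHom x) h1
    exact congrFun (congrArg Subtype.val h2) ⟨σ, Finset.mem_singleton_self σ⟩
  · refine WeaklyCompleteAlg.hom_ext_of_toFiniteImage fun s => (hs s).hom_ext ?_
    dsimp only at hf''
    rw [hf' s, hg, Functor.map_comp, reassoc_of% hf'']

/-- The unit is the explicit map `toEnvelopingObj`, whose existence and uniqueness statements apply
directly. -/
theorem extendsUniquely_unit (L : ProfiniteLie.{u} K) (A : WeaklyCompleteAlg.{u} K) :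
    ExtendsUniquely (W := (envelopingFunctor K).obj L) ((envelopingAdjunction K).unit.app L) A := by
  intro f
  rw [envelopingAdjunction_unit_app]
  obtain ⟨f', hf'⟩ := exists_envelopingObj_hom f
  exact ⟨f', hf', fun g hg => envelopingObj_hom_ext g f' (hg.trans hf'.symm)⟩

/-- Two solutions of the same universal problem are isomorphic, by a unique isomorphism. -/
theorem existsUnique_iso_of_extendsUniquely {W' : WeaklyCompleteAlg.{u} K}
    {j' : L ⟶ (lieFunctor K).obj W'} (h : ∀ A, ExtendsUniquely j A)
    (h' : ∀ A, ExtendsUniquely j' A) :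
    ∃! e : W ≅ W', j ≫ (lieFunctor K).map e.hom = j' := by
  obtain ⟨a, ha, ha'⟩ := h W' j'
  obtain ⟨b, hb, -⟩ := h' W j
  -- Each composite of `a` and `b` fixes `j` or `j'`, hence is the identity. Uniqueness already
  -- holds among all morphisms, not only isomorphisms.
  refine ⟨⟨a, b, (h W).hom_ext ?_, (h' W').hom_ext ?_⟩, ha, fun e he => Iso.ext (ha' _ he)⟩
  · rw [Functor.map_comp, reassoc_of% ha, hb, CategoryTheory.Functor.map_id, Category.comp_id]
  · rw [Functor.map_comp, reassoc_of% hb, ha, CategoryTheory.Functor.map_id, Category.comp_id]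

end UniversalProperty

/-! ### The two universal characterizations -/

theorem proposition1p9 (K : Type) [RCLike K] :
    (∀ (L : ProfiniteLie.{u} K) (W : WeaklyCompleteAlg.{u} K) (j : L ⟶ (lieFunctor K).obj W),
      (∀ A : WeaklyCompleteAlg.{u} K, FiniteDimensional K A → ExtendsUniquely j A) →
        (∀ A : WeaklyCompleteAlg.{u} K, ExtendsUniquely j A) ∧
        ∃! e : W ≅ (envelopingFunctor K).obj L,
          j ≫ (lieFunctor K).map e.hom = (envelopingAdjunction K).unit.app L) ∧
    (∀ (V : ProfiniteLie.{u} K ⥤ WeaklyCompleteAlg.{u} K)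
      (ν : 𝟭 (ProfiniteLie.{u} K) ⟶ V ⋙ lieFunctor K),
      (∀ (L : ProfiniteLie.{u} K) (A : WeaklyCompleteAlg.{u} K), FiniteDimensional K A →
        ExtendsUniquely (W := V.obj L) (ν.app L) A) →
        ∃! e : V ≅ envelopingFunctor K, ∀ L : ProfiniteLie.{u} K,
          ν.app L ≫ (lieFunctor K).map (e.hom.app L) = (envelopingAdjunction K).unit.app L) := by
  refine ⟨fun L W j h => ?_, fun V ν h => ?_⟩
  · have hW := ExtendsUniquely.of_finiteDimensional h
    exact ⟨hW, existsUnique_iso_of_extendsUniquely hW (extendsUniquely_unit L)⟩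
  · have hV := fun L => ExtendsUniquely.of_finiteDimensional (h L)
    choose e he he' using fun L =>
      existsUnique_iso_of_extendsUniquely (hV L) (extendsUniquely_unit L)
    dsimp only at he
    -- Naturality can be checked after precomposing with `ν.app L`; there both sides equal `f`
    -- followed by the unit at `M`, by naturality of `ν` and of the unit.
    refine ⟨NatIso.ofComponents e fun {L M} f => (hV L _).hom_ext ?_, he, fun e' h' => ?_⟩
    · have h1 : f ≫ ν.app M = ν.app L ≫ (lieFunctor K).map (V.map f) := ν.naturality f
      have h2 : f ≫ (envelopingAdjunction K).unit.app M = (envelopingAdjunction K).unit.app L ≫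
          (lieFunctor K).map ((envelopingFunctor K).map f) :=
        (envelopingAdjunction K).unit.naturality f
      rw [Functor.map_comp, Functor.map_comp, ← reassoc_of% h1, reassoc_of% he L]
      exact (congrArg (f ≫ ·) (he M)).trans h2
    -- A natural isomorphism is determined by its components, and each of these is unique.
    · ext L : 3
      exact congrArg Iso.hom (he' L (e'.app L) (h' L))
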